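/- Let $w:\mathbb R\to\mathbb R$ be bounded, non-negative, even and integrable with $\int w=1$ and $C_w=\int|x|\,w(x)\,dx<\infty$. For a bounded measurable $p$ write $p^w(x)=\int p(y)\,w(x-y)\,dy$. Let $h_f,h_g:[0,1]\to[0,1]$ be non-decreasing with $h_f(0)=h_g(0)=0$ and $h_f(1)=h_g(1)=1$, with generalized inverses $h^{-1}(v)=\inf\{u\in[0,1]: h(u)\ge v\}$, put $$\phi(u,v)=\int_0^u h_g^{-1}(s)\,ds+\int_0^v h_f^{-1}(t)\,dt-uv ,$$ and assume $\phi(1,1)=0$. A function $p:\mathbb R\to[0,1]$ is called interpolating if $p(x)\to0$ as $x\to-\infty$ and $p(x)\to1$ as $x\to+\infty$. For monotone (non-decreasing) interpolating $f,g$ put $$\mathcal W(f,g)=\lim_{A,B\to\infty}\int_{-A}^{B}\Bigl(\int_0^{g(x)}h_g^{-1}(u)\,du+\int_0^{f(x)}h_f^{-1}(v)\,dv-f^w(x)\,g(x)\Bigr)dx\in[-\infty,\infty],$$ to be read as a $\liminf$ if the limit does not exist. (If the positive gap condition holds, that is, if $\phi\ge0$ on $[0,1]^2$, then the limit always exists and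 lies in $[0,\infty]$.) The pair $(f,g)$ is called minimal if the limit $\mathcal W(f,g)$ exists, is not $-\infty$, and $\mathcal W(f,g)\le\mathcal W(f',g')$ for all monotone interpolating $f',g'$. It is called a consistent fixed point (CFP) of the coupled density evolution equations $f=h_f\circ g^w$, $g=h_g\circ f^w$ if for every $x\in\mathbb R$ $$f(x)\in\bigl[h_f(g^w(x)-),\,h_f(g^w(x)+)\bigr],\qquad g(x)\in\bigl[h_g(f^w(x)-),\,h_g(f^w(x)+)\bigr],$$ where $h(u-)$ and $h(u+)$ are the left and right limits of $h$ at $u$, with $h(0-)=0$ and $h(1+)=1$ (so equality holds wherever the update function is continuous). Proposition. Let $f,g$ be monotone and interpolating. Then $(f,g)$ is minimal if and only if $(f,g)$ is a CFP. -/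

import Mathlib

open MeasureTheory Filter Topology Set

noncomputable section

namespace SpatialCoupling

/-- An averaging window `w : ℝ → ℝ`: bounded, nonnegative, even, integrable, of total mass one, and
with finite first absolute moment `C_w = ∫ |x| w(x) dx`. -/
structure IsWindow (w : ℝ → ℝ) : Prop where
  bounded : ∃ M : ℝ, ∀ x, w x ≤ M
  nonneg : ∀ x, 0 ≤ w x
  even : ∀ x, w (-x) = w x
  integrable : Integrable w
  integral_eq_one : ∫ x, w x = 1
  integrable_abs_mul : Integrable (fun x => |x| * w x)

/-- An update function: a nondecreasing map `[0,1] → [0,1]` with `h 0 = 0` and `h 1 = 1`.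
The values of `h` outside `[0,1]` are never used. -/
structure IsUpdate (h : ℝ → ℝ) : Prop where
  mapsTo : MapsTo h (Icc 0 1) (Icc 0 1)
  monotoneOn : MonotoneOn h (Icc 0 1)
  map_zero : h 0 = 0
  map_one : h 1 = 1

/-- An interpolating profile: `p : ℝ → [0,1]` with limit `0` at `-∞` and limit `1` at `+∞`. -/
structure IsInterpolating (p : ℝ → ℝ) : Prop where
  mem_Icc : ∀ x, p x ∈ Icc (0 : ℝ) 1
  tendsto_atBot : Tendsto p atBot (𝓝 0)
  tendsto_atTop : Tendsto p atTop (𝓝 1)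

/-- The smoothed profile `p^w = p ⊗ w`, that is `p^w(x) = ∫ p(y) w(x - y) dy`. -/
def smooth (w p : ℝ → ℝ) : ℝ → ℝ :=
  convolution p w (ContinuousLinearMap.mul ℝ ℝ) volume

/-- The generalized inverse `h⁻¹(v) = inf {u ∈ [0,1] | v ≤ h u}` of an update function, for
`v ∈ [0,1]`.  Any two versions of the inverse agree off a countable set, so that
the integrals below do not depend on the choice. -/
def updateInv (h : ℝ → ℝ) (v : ℝ) : ℝ :=
  sInf {u : ℝ | u ∈ Icc (0 : ℝ) 1 ∧ v ≤ h u}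

/-- `H(t) = ∫₀ᵗ h⁻¹(v) dv`. -/
def updatePrim (h : ℝ → ℝ) (t : ℝ) : ℝ :=
  ∫ v in (0 : ℝ)..t, updateInv h v

/-- The potential `φ(h_f, h_g; u, v) = ∫₀ᵘ h_g⁻¹ + ∫₀ᵛ h_f⁻¹ - u v` of the uncoupled system. -/
def phi (hf hg : ℝ → ℝ) (u v : ℝ) : ℝ :=
  updatePrim hg u + updatePrim hf v - u * v

/-- The integrand
`I_{f,g,w}(x) = ∫₀^{g(x)} h_g⁻¹(u) du + ∫₀^{f(x)} h_f⁻¹(v) dv - f^w(x) g(x)`. -/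
def potentialIntegrand (w hf hg f g : ℝ → ℝ) (x : ℝ) : ℝ :=
  updatePrim hg (g x) + updatePrim hf (f x) - smooth w f x * g x

/-- `∫_{-A}^{B} I_{f,g,w}(x) dx`, as an extended real number, at `AB = (A, B)`. -/
def truncatedPotential (w hf hg f g : ℝ → ℝ) (AB : ℝ × ℝ) : EReal :=
  ((∫ x in (-AB.1)..AB.2, potentialIntegrand w hf hg f g x : ℝ) : EReal)

/-- The potential functional `𝒲(f,g) = lim_{A,B → ∞} ∫_{-A}^{B} I_{f,g,w}(x) dx`, written as a
lower limit so that it has a value in `[-∞, ∞]` for every pair; it is the limit whenever that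
exists, see `potential_eq_of_tendsto`. -/
def potential (w hf hg f g : ℝ → ℝ) : EReal :=
  liminf (truncatedPotential w hf hg f g) (atTop ×ˢ atTop)

theorem potential_eq_of_tendsto {w hf hg f g : ℝ → ℝ} {L : EReal}
    (h : Tendsto (truncatedPotential w hf hg f g) (atTop ×ˢ atTop) (𝓝 L)) :
    potential w hf hg f g = L :=
  h.liminf_eq

/-- `(f,g)` minimizes `𝒲` among the monotone interpolating pairs: `𝒲(f,g)` is well defined as a
limit, with a value in `(-∞, ∞]`, and `𝒲(f,g) ≤ 𝒲(f',g')` for all monotone interpolating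
`f'`, `g'`. -/
def IsMinimalPair (w hf hg f g : ℝ → ℝ) : Prop :=
  Tendsto (truncatedPotential w hf hg f g) (atTop ×ˢ atTop) (𝓝 (potential w hf hg f g)) ∧
  potential w hf hg f g ≠ ⊥ ∧
  ∀ f' g' : ℝ → ℝ, Monotone f' → Monotone g' → IsInterpolating f' → IsInterpolating g' →
    potential w hf hg f g ≤ potential w hf hg f' g'

/-- The update function continued to the real line by the constants `h 0 = 0` to the left of `0` and
`h 1 = 1` to the right of `1`; this fixes the one-sided limits `h(0-) = 0` and `h(1+) = 1`. -/
def updateExt (h : ℝ → ℝ) (u : ℝ) : ℝ :=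
  h (max 0 (min u 1))

/-- `v ≐ h(u)`: `v ∈ [h(u-), h(u+)]`, which says `v = h u` where `h` is continuous. -/
def ConsistentValue (h : ℝ → ℝ) (u v : ℝ) : Prop :=
  v ∈ Icc (Function.leftLim (updateExt h) u) (Function.rightLim (updateExt h) u)

/-- `(f,g)` is a consistent fixed point: `f ≐ h_f ∘ g^w` and `g ≐ h_g ∘ f^w`. -/
def IsCFP (w hf hg f g : ℝ → ℝ) : Prop :=
  (∀ x, ConsistentValue hf (smooth w g x) (f x)) ∧
  (∀ x, ConsistentValue hg (smooth w f x) (g x))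

end SpatialCoupling

end

noncomputable section

namespace SpatialCoupling

/-! Let `a`, `b` be quantile functions of `f`, `g`, and let `W` be the distribution function of `w`.
A profile is a mixture of unit steps placed at its quantiles, so `f^w(x) = ∫ W(x - a(v)) dv` over
`(0,1)`, and likewise for `g`.

CFP implies minimal. Consistency says `h_f⁻¹(v) = g^w(a(v))` and `h_g⁻¹(u) = f^w(b(u))`
(`updateInv_eq_of_consistent`). Both are averages of `W` at differences of quantiles, and `W(-d) = 1
- W(d)`, so `φ` becomes an integral over the unit square of a nonnegative density
(`phi_eq_integral`). Hence a CFP forces the positive gap condition. Split the potential integrand as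
`φ(g,f) + (f - f^w) g` and integrate over `x` first. With `d = b(u) - a(v)` for the CFP and `e =
b'(u) - a'(v)` for a competitor, the competitor's potential is the integral over the square of `max
e 0 - W(d) e + K(e)` (`lintegral_phi`, `integrable_interaction`). The function `max e 0 + K(e)` is
convex with derivative `W(e)`, so the integrand is smallest at `e = d`, pointwise in `(u,v)`
(`posPart_add_tail_convex`). Thus the CFP minimizes, with no variational argument needed.

Minimal implies CFP. A pair of unit steps has finite potential, so the minimum is a real number and
the change under a compactly supported perturbation of one profile is nonnegative. Where consistency
fails, capping the profile from above on a left half-line, or from below on a right half-line, keeps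
it monotone and strictly lowers the potential (`le_rightLim_of_stationary`,
`leftLim_le_of_stationary`). -/

/-! ### The distribution function of a window -/

/-- The distribution function `W(x) = ∫_{-∞}^x w` of a window. -/
def windowCdf (w : ℝ → ℝ) (x : ℝ) : ℝ :=
  ∫ t in Iic x, w t

/-- The difference `1_{[0,∞)} - W` between the unit step and the smoothed unit step. -/
def stepDefect (w : ℝ → ℝ) (s : ℝ) : ℝ :=
  (if 0 ≤ s then 1 else 0) - windowCdf w s

/-- The tail integral `K(d) = ∫_d^∞ (1_{[0,∞)} - W)`. -/
def stepDefectTail (w : ℝ → ℝ) (d : ℝ) : ℝ :=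
  ∫ s in Ici d, stepDefect w s

namespace IsWindow

variable {w : ℝ → ℝ} (hw : IsWindow w)
include hw

theorem windowCdf_nonneg (x : ℝ) : 0 ≤ windowCdf w x :=
  integral_nonneg fun t => hw.nonneg t

theorem windowCdf_le_one (x : ℝ) : windowCdf w x ≤ 1 := by
  rw [← hw.integral_eq_one]
  exact setIntegral_le_integral hw.integrable (ae_of_all _ hw.nonneg)

theorem windowCdf_neg (x : ℝ) : windowCdf w (-x) = 1 - windowCdf w x := by
  have h1 : ∫ t in Ioi x, w (-t) = ∫ t in Iic (-x), w t := integral_comp_neg_Ioi x w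
  simp only [hw.even] at h1
  have h2 := intervalIntegral.integral_Iic_add_Ioi (b := x) hw.integrable.integrableOn
    hw.integrable.integrableOn
  rw [hw.integral_eq_one] at h2
  unfold windowCdf
  linarith

theorem windowCdf_sub_comm (x y : ℝ) : windowCdf w (x - y) = 1 - windowCdf w (y - x) := by
  rw [← hw.windowCdf_neg, neg_sub]

theorem windowCdf_mono : Monotone (windowCdf w) := fun _ _ hxy =>
  setIntegral_mono_set hw.integrable.integrableOn (ae_of_all _ hw.nonneg)
    (Iic_subset_Iic.2 hxy).eventuallyLE

theorem windowCdf_continuous : Continuous (windowCdf w) := by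
  have h : windowCdf w = fun x => windowCdf w 0 + ∫ t in (0 : ℝ)..x, w t := by
    funext x
    have := intervalIntegral.integral_Iic_sub_Iic (a := 0) (b := x)
      hw.integrable.integrableOn hw.integrable.integrableOn
    unfold windowCdf
    linarith
  rw [h]
  exact continuous_const.add (intervalIntegral.continuous_primitive
    (fun a b => hw.integrable.intervalIntegrable) 0)

theorem stepDefect_measurable : Measurable (stepDefect w) :=
  (Measurable.ite measurableSet_Ici measurable_const measurable_const).sub
    hw.windowCdf_continuous.measurable

/-- The defect is the `w(t) dt`-average of the differences of unit steps at `0` and at `t`. Each has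
`L¹` norm `|t|`, so the finite first moment of `w` is exactly what Fubini needs. -/
theorem stepDefect_integrable : Integrable (stepDefect w) := by
  have hmeas : AEStronglyMeasurable
      (fun z : ℝ × ℝ => ((if 0 ≤ z.1 then 1 else 0) - (if z.2 ≤ z.1 then 1 else 0) : ℝ) * w z.2)
      (volume.prod volume) := by
    refine AEStronglyMeasurable.mul ?_ hw.integrable.aestronglyMeasurable.comp_snd
    refine Measurable.aestronglyMeasurable ?_
    exact (Measurable.ite (measurableSet_le measurable_const measurable_fst) measurable_const
      measurable_const).sub (Measurable.ite (measurableSet_le measurable_snd measurable_fst)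
        measurable_const measurable_const)
  have hslice : ∀ t s : ℝ, ‖((if 0 ≤ s then 1 else 0) - (if t ≤ s then 1 else 0) : ℝ)‖ =
      (Ico (min 0 t) (max 0 t)).indicator 1 s := by
    intro t s
    simp only [indicator, mem_Ico, min_le_iff, lt_max_iff, Pi.one_apply]
    split_ifs <;> first | (exfalso; grind) | norm_num
  have hint : Integrable
      (fun z : ℝ × ℝ => ((if 0 ≤ z.1 then 1 else 0) - (if z.2 ≤ z.1 then 1 else 0) : ℝ) * w z.2)
      (volume.prod volume) := by
    rw [integrable_prod_iff' hmeas]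
    constructor
    · refine ae_of_all _ fun t => ?_
      refine Integrable.mul_const (f := fun s : ℝ => ((if 0 ≤ s then 1 else 0) -
        (if t ≤ s then 1 else 0) : ℝ)) ?_ (w t)
      refine (integrable_norm_iff ?_).1 ?_
      · refine Measurable.aestronglyMeasurable ?_
        exact (Measurable.ite measurableSet_Ici measurable_const measurable_const).sub
          (Measurable.ite measurableSet_Ici measurable_const measurable_const)
      · simp only [hslice]
        exact (integrable_indicator_iff measurableSet_Ico).2
          (integrableOn_const (by simp))
    · refine hw.integrable_abs_mul.congr (ae_of_all _ fun t => ?_)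
      simp only [norm_mul, hslice, integral_mul_const, Real.norm_of_nonneg (hw.nonneg t)]
      rw [integral_indicator measurableSet_Ico]
      congr 1
      simp [max_sub_min_eq_abs]
  refine hint.integral_prod_left.congr (ae_of_all _ fun s => ?_)
  have e : ∀ t, ((if 0 ≤ s then 1 else 0) - (if t ≤ s then 1 else 0) : ℝ) * w t =
      (if 0 ≤ s then 1 else 0) * w t - (Iic s).indicator w t := by
    intro t
    simp only [indicator, mem_Iic]
    split_ifs <;> ring
  simp only [e]
  rw [integral_sub (hw.integrable.const_mul _) (hw.integrable.indicator measurableSet_Iic),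
    integral_const_mul, integral_indicator measurableSet_Iic, hw.integral_eq_one, mul_one]
  rfl

theorem stepDefectTail_sub (d e : ℝ) :
    stepDefectTail w e - stepDefectTail w d =
      ∫ x in d..e, (windowCdf w x - (if 0 ≤ x then 1 else 0)) := by
  have h := hw.stepDefect_integrable
  have h1 := intervalIntegral.integral_Iic_add_Ioi (b := d) h.integrableOn h.integrableOn
  have h2 := intervalIntegral.integral_Iic_add_Ioi (b := e) h.integrableOn h.integrableOn
  have h3 := intervalIntegral.integral_Iic_sub_Iic (a := d) (b := e) h.integrableOn h.integrableOn
  have h4 : ∫ x in d..e, (windowCdf w x - (if 0 ≤ x then 1 else 0)) =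
      -∫ x in d..e, stepDefect w x := by
    rw [← intervalIntegral.integral_neg]
    simp [stepDefect]
  unfold stepDefectTail
  rw [h4, integral_Ici_eq_integral_Ioi, integral_Ici_eq_integral_Ioi]
  linarith

theorem abs_stepDefectTail_le (d : ℝ) : ‖stepDefectTail w d‖ ≤ ∫ s, ‖stepDefect w s‖ :=
  (norm_integral_le_integral_norm _).trans
    (setIntegral_le_integral hw.stepDefect_integrable.norm (ae_of_all _ fun _ => norm_nonneg _))

theorem stepDefectTail_continuous : Continuous (stepDefectTail w) := by
  have h : stepDefectTail w = fun e => stepDefectTail w 0 +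
      ∫ x in (0 : ℝ)..e, (windowCdf w x - (if 0 ≤ x then 1 else 0)) := by
    funext e
    rw [← hw.stepDefectTail_sub]
    ring
  rw [h]
  refine continuous_const.add (intervalIntegral.continuous_primitive (fun a b => ?_) 0)
  have : (fun x => windowCdf w x - (if 0 ≤ x then (1 : ℝ) else 0)) = fun x => -stepDefect w x := by
    funext x
    simp [stepDefect]
  rw [this]
  exact hw.stepDefect_integrable.neg.intervalIntegrable

/-- Convexity of `t ↦ max t 0 + K t`, whose derivative is `W`. -/
theorem posPart_add_tail_convex (d e : ℝ) :
    max d 0 - windowCdf w d * d + stepDefectTail w d ≤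
      max e 0 - windowCdf w d * e + stepDefectTail w e := by
  have hstep : ∀ a b : ℝ, IntervalIntegrable (fun x : ℝ => if 0 ≤ x then (1 : ℝ) else 0)
      volume a b := by
    intro a b
    refine Monotone.intervalIntegrable fun x y hxy => ?_
    show (if 0 ≤ x then (1 : ℝ) else 0) ≤ if 0 ≤ y then 1 else 0
    split_ifs <;> linarith
  have hpos : ∀ a : ℝ, ∫ x in (0 : ℝ)..a, (if 0 ≤ x then (1 : ℝ) else 0) = max a 0 := by
    intro a
    rcases le_total 0 a with ha | ha
    · rw [intervalIntegral.integral_congr (g := fun _ => (1 : ℝ))]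
      · simp [ha]
      · intro x hx
        rw [uIcc_of_le ha] at hx
        simp [hx.1]
    · rw [intervalIntegral.integral_symm, intervalIntegral.integral_congr_ae (g := fun _ => (0 : ℝ))]
      · simp [ha]
      · have : ∀ᵐ x : ℝ, x ≠ 0 := by simp [ae_iff, measure_singleton]
        filter_upwards [this] with x hx h
        rw [uIoc_of_le ha] at h
        have : ¬ 0 ≤ x := fun h0 => hx (le_antisymm h.2 h0)
        simp [this]
  have hposdiff : ∫ x in d..e, (if 0 ≤ x then (1 : ℝ) else 0) = max e 0 - max d 0 := by
    rw [← hpos, ← hpos, intervalIntegral.integral_interval_sub_left (hstep _ _) (hstep _ _)]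
  have hW : ∀ a b, IntervalIntegrable (windowCdf w) volume a b := fun a b =>
    hw.windowCdf_continuous.intervalIntegrable a b
  have htail := hw.stepDefectTail_sub d e
  rw [intervalIntegral.integral_sub (hW _ _) (hstep _ _), hposdiff] at htail
  -- Monotonicity of `W` makes `W(d)` a subgradient at `d` of its primitive, for `e` on either side
  -- of `d`.
  have hmono : windowCdf w d * (e - d) ≤ ∫ x in d..e, windowCdf w x := by
    rcases le_total d e with h | h
    · calc windowCdf w d * (e - d) = ∫ _ in d..e, windowCdf w d := by simp [mul_comm]
        _ ≤ _ := intervalIntegral.integral_mono_on h (by simp) (hW _ _)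
          fun x hx => hw.windowCdf_mono hx.1
    · rw [intervalIntegral.integral_symm]
      have : ∫ x in e..d, windowCdf w x ≤ ∫ _ in e..d, windowCdf w d :=
        intervalIntegral.integral_mono_on h (hW _ _) (by simp) fun x hx => hw.windowCdf_mono hx.2
      simp only [intervalIntegral.integral_const, smul_eq_mul] at this
      linarith
  linarith

end IsWindow

/-! ### Quantile functions -/

/-- Lebesgue measure on `(0,1)`. -/
abbrev unitMeasure : Measure ℝ := volume.restrict (Ioo 0 1)

instance : IsProbabilityMeasure unitMeasure := ⟨by simp⟩

theorem ae_unitMeasure_mem : ∀ᵐ v ∂unitMeasure, v ∈ Ioo (0 : ℝ) 1 :=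
  ae_restrict_mem measurableSet_Ioo

/-- `a` is a quantile function of the monotone profile `p`. -/
structure IsQuantile (p a : ℝ → ℝ) : Prop where
  measurable : Measurable a
  le_of_le : ∀ v ∈ Ioo (0 : ℝ) 1, ∀ x, v ≤ p x → a v ≤ x
  le_of_lt : ∀ v ∈ Ioo (0 : ℝ) 1, ∀ x, a v < x → v ≤ p x

theorem exists_isQuantile {p : ℝ → ℝ} (hp : Monotone p) (hi : IsInterpolating p) :
    ∃ a, IsQuantile p a := by
  classical
  have hbdd : ∀ v ∈ Ioo (0 : ℝ) 1, BddBelow {x | v ≤ p x} := by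
    intro v hv
    obtain ⟨y, hy⟩ := (hi.tendsto_atBot.eventually (gt_mem_nhds hv.1)).exists
    refine ⟨y, fun x hx => ?_⟩
    by_contra! h
    exact absurd (hp h.le) (not_le.2 (hy.trans_le hx))
  have hne : ∀ v ∈ Ioo (0 : ℝ) 1, {x | v ≤ p x}.Nonempty := by
    intro v hv
    obtain ⟨y, hy⟩ := (hi.tendsto_atTop.eventually (lt_mem_nhds hv.2)).exists
    exact ⟨y, hy.le⟩
  -- The infimum is meaningful only for `0 < v < 1`, where the two limits of the profile make the
  -- set nonempty and bounded below; `0` is a default value elsewhere.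
  refine ⟨(Ioo 0 1).piecewise (fun v => sInf {x | v ≤ p x}) 0, ?_, ?_, ?_⟩
  · refine measurable_of_restrict_of_restrict_compl (s := Ioo 0 1) measurableSet_Ioo ?_ ?_
    · rw [domRestrict_piecewise]
      refine Monotone.measurable fun u v huv => ?_
      exact csInf_le_csInf (hbdd _ u.2) (hne _ v.2) fun x hx => le_trans (Subtype.coe_le_coe.2 huv) hx
    · rw [domRestrict_piecewise_compl]
      exact measurable_const
  · intro v hv x hx
    simp only [piecewise_eq_of_mem _ _ _ hv]
    exact csInf_le (hbdd v hv) hx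
  · intro v hv x hx
    simp only [piecewise_eq_of_mem _ _ _ hv] at hx
    obtain ⟨y, hy, hyx⟩ := (csInf_lt_iff (hbdd v hv) (hne v hv)).1 hx
    exact le_trans hy (hp hyx.le)

theorem integral_unitMeasure_le {c : ℝ} (hc : c ∈ Icc (0 : ℝ) 1) :
    ∫ v, (if v ≤ c then (1 : ℝ) else 0) ∂unitMeasure = c := by
  have h : (fun v : ℝ => if v ≤ c then (1 : ℝ) else 0) = (Iic c).indicator 1 := by
    funext v
    simp [indicator]
  rw [h, integral_indicator_one measurableSet_Iic, measureReal_restrict_apply measurableSet_Iic]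
  rcases hc.2.lt_or_eq with h1 | h1
  · have : Iic c ∩ Ioo (0 : ℝ) 1 = Ioc 0 c := by
      ext v
      simp only [mem_inter_iff, mem_Iic, mem_Ioo, mem_Ioc]
      constructor
      · rintro ⟨h, h', -⟩
        exact ⟨h', h⟩
      · rintro ⟨h, h'⟩
        exact ⟨h', h, h'.trans_lt h1⟩
    simp [this, hc.1]
  · have : Iic c ∩ Ioo (0 : ℝ) 1 = Ioo 0 1 := by
      rw [h1]
      exact inter_eq_right.2 fun v hv => hv.2.le
    rw [this]
    simp [h1]

namespace IsQuantile

variable {p a w : ℝ → ℝ}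

/-- The equivalence can fail only where `a v = x`, since the profile need not be right-continuous.
For fixed `v` this is a single `x`, so by Fubini it is negligible in `v` for almost every `x`. -/
theorem ae_le_iff (ha : IsQuantile p a) :
    ∀ᵐ x, ∀ᵐ v ∂unitMeasure, (a v ≤ x ↔ v ≤ p x) := by
  have h : ∀ᵐ x, ∀ᵐ v ∂unitMeasure, a v ≠ x := by
    refine (Measure.ae_ae_comm (p := fun v x => a v ≠ x) ?_).1 (ae_of_all _ fun v => ?_)
    · exact (measurableSet_eq_fun (ha.measurable.comp measurable_fst) measurable_snd).compl
    · simp [ae_iff]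
  filter_upwards [h] with x hx
  filter_upwards [hx, ae_unitMeasure_mem] with v hv hv'
  exact ⟨fun hle => ha.le_of_lt v hv' x (hle.lt_of_ne hv), ha.le_of_le v hv' x⟩

theorem ae_eq_integral (ha : IsQuantile p a) (hi : IsInterpolating p) :
    ∀ᵐ x, p x = ∫ v, (if a v ≤ x then (1 : ℝ) else 0) ∂unitMeasure := by
  filter_upwards [ha.ae_le_iff] with x hx
  rw [← integral_unitMeasure_le (hi.mem_Icc x)]
  refine integral_congr_ae ?_
  filter_upwards [hx] with v hv
  simp [hv]

/-- Smoothing commutes with the mixture of unit steps at the quantiles, and a smoothed unit step is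
a translate of `W`. -/
theorem smooth_eq (ha : IsQuantile p a) (hi : IsInterpolating p) (hw : IsWindow w) (x : ℝ) :
    smooth w p x = ∫ v, windowCdf w (x - a v) ∂unitMeasure := by
  have h0 : smooth w p x = ∫ t, p t * w (x - t) := rfl
  have h1 : ∫ t, p t * w (x - t) =
      ∫ t, ∫ v, (if a v ≤ t then (1 : ℝ) else 0) * w (x - t) ∂unitMeasure := by
    refine integral_congr_ae ?_
    filter_upwards [ha.ae_eq_integral hi] with t ht
    simp only [integral_mul_const, ← ht]
  have hwx : Integrable (fun t => w (x - t)) := hw.integrable.comp_sub_left x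
  rw [h0, h1, integral_integral_swap]
  · refine integral_congr_ae (ae_of_all _ fun v => ?_)
    have e : (fun t => (if a v ≤ t then (1 : ℝ) else 0) * w (x - t)) =
        fun t => (Iic (x - a v)).indicator w (x - t) := by
      funext t
      simp only [indicator, mem_Iic, sub_le_sub_iff_left, ite_mul, one_mul, zero_mul]
    simp only [e]
    rw [integral_sub_left_eq_self, integral_indicator measurableSet_Iic]
    rfl
  · refine Integrable.mono' (hwx.norm.comp_fst unitMeasure) ?_ (ae_of_all _ fun z => ?_)
    · refine AEStronglyMeasurable.mul ?_ hwx.aestronglyMeasurable.comp_fst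
      exact (Measurable.ite (measurableSet_le (ha.measurable.comp measurable_snd) measurable_fst)
        measurable_const measurable_const).aestronglyMeasurable
    · simp only [Function.uncurry, norm_mul]
      refine mul_le_of_le_one_left (norm_nonneg _) ?_
      split_ifs <;> simp

end IsQuantile

theorem integrable_of_measurable_bound {α : Type*} [MeasurableSpace α] {μ : Measure α}
    [IsFiniteMeasure μ] {F : α → ℝ} (hF : Measurable F) (h0 : ∀ x, 0 ≤ F x) (h1 : ∀ x, F x ≤ 1) :
    Integrable F μ :=
  Integrable.of_bound hF.aestronglyMeasurable 1
    (ae_of_all _ fun x => by rw [Real.norm_of_nonneg (h0 x)]; exact h1 x)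

/-! ### Regularity of smoothed profiles -/

section smooth

variable {p w : ℝ → ℝ} (hw : IsWindow w) (hp : Monotone p) (hi : IsInterpolating p)
include hw hp hi

theorem smooth_continuous : Continuous (smooth w p) := by
  obtain ⟨a, ha⟩ := exists_isQuantile hp hi
  rw [funext (ha.smooth_eq hi hw)]
  refine continuous_of_dominated (bound := fun _ => 1) (fun x => ?_) (fun x => ae_of_all _ fun v => ?_)
    (integrable_const 1) (ae_of_all _ fun v => ?_)
  · exact (hw.windowCdf_continuous.measurable.comp
      (measurable_const.sub ha.measurable)).aestronglyMeasurable
  · rw [Real.norm_of_nonneg (hw.windowCdf_nonneg _)]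
    exact hw.windowCdf_le_one _
  · exact hw.windowCdf_continuous.comp (continuous_id.sub continuous_const)

theorem smooth_mono : Monotone (smooth w p) := by
  obtain ⟨a, ha⟩ := exists_isQuantile hp hi
  have hint : ∀ x, Integrable (fun v => windowCdf w (x - a v)) unitMeasure := fun x =>
    integrable_of_measurable_bound (hw.windowCdf_continuous.measurable.comp
      (measurable_const.sub ha.measurable)) (fun _ => hw.windowCdf_nonneg _)
      fun _ => hw.windowCdf_le_one _
  intro x y hxy
  rw [ha.smooth_eq hi hw, ha.smooth_eq hi hw]
  exact integral_mono (hint x) (hint y) fun v => hw.windowCdf_mono (by linarith)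

theorem smooth_mem_Icc (x : ℝ) : smooth w p x ∈ Icc (0 : ℝ) 1 := by
  obtain ⟨a, ha⟩ := exists_isQuantile hp hi
  rw [ha.smooth_eq hi hw]
  refine ⟨integral_nonneg fun v => hw.windowCdf_nonneg _, ?_⟩
  calc ∫ v, windowCdf w (x - a v) ∂unitMeasure ≤ ∫ _, (1 : ℝ) ∂unitMeasure :=
        integral_mono (integrable_of_measurable_bound (hw.windowCdf_continuous.measurable.comp
          (measurable_const.sub ha.measurable)) (fun _ => hw.windowCdf_nonneg _)
          fun _ => hw.windowCdf_le_one _) (integrable_const 1) fun v => hw.windowCdf_le_one _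
    _ = 1 := by simp

end smooth

/-! ### Update functions and their generalized inverses -/

namespace IsUpdate

variable {h : ℝ → ℝ} (hh : IsUpdate h)
include hh

theorem updateExt_mono : Monotone (updateExt h) := fun _ _ hxy =>
  hh.monotoneOn ⟨le_max_left _ _, max_le zero_le_one (min_le_right _ _)⟩
    ⟨le_max_left _ _, max_le zero_le_one (min_le_right _ _)⟩
    (max_le_max le_rfl (min_le_min hxy le_rfl))

omit hh in
theorem updateExt_eq {u : ℝ} (hu : u ∈ Icc (0 : ℝ) 1) : updateExt h u = h u := by
  rw [updateExt, min_eq_left hu.2, max_eq_right hu.1]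

theorem updateExt_of_nonpos {u : ℝ} (hu : u ≤ 0) : updateExt h u = 0 := by
  rw [updateExt, max_eq_left ((min_le_left _ _).trans hu), hh.map_zero]

theorem updateExt_mem_Icc (u : ℝ) : updateExt h u ∈ Icc (0 : ℝ) 1 :=
  hh.mapsTo ⟨le_max_left _ _, max_le zero_le_one (min_le_right _ _)⟩

omit hh in
theorem bddBelow_updateInv (v : ℝ) : BddBelow {u : ℝ | u ∈ Icc (0 : ℝ) 1 ∧ v ≤ h u} :=
  ⟨0, fun _ hu => hu.1.1⟩

theorem nonempty_updateInv {v : ℝ} (hv : v ≤ 1) : {u : ℝ | u ∈ Icc (0 : ℝ) 1 ∧ v ≤ h u}.Nonempty :=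
  ⟨1, ⟨zero_le_one, le_rfl⟩, by rwa [hh.map_one]⟩

omit hh in
theorem updateInv_nonneg (v : ℝ) : 0 ≤ updateInv h v :=
  Real.sInf_nonneg fun _ hu => hu.1.1

theorem updateInv_le_one {v : ℝ} (hv : v ≤ 1) : updateInv h v ≤ 1 :=
  csInf_le (bddBelow_updateInv v) ⟨⟨zero_le_one, le_rfl⟩, by rwa [hh.map_one]⟩

theorem updateInv_monotoneOn : MonotoneOn (updateInv h) (Iic 1) := fun _ _ _ hy hxy =>
  csInf_le_csInf (bddBelow_updateInv _) (hh.nonempty_updateInv hy) fun _ hu => ⟨hu.1, hxy.trans hu.2⟩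

/-- Together with `le_updateInv_of_lt` this replaces a Galois connection for the extended update
function. Positivity of `v` rules out `s ≤ 0`, where the extension vanishes and `s` could lie below
the infimum. -/
theorem updateInv_le_of_le {s v : ℝ} (hv : v ∈ Ioc (0 : ℝ) 1) (h1 : v ≤ updateExt h s) :
    updateInv h v ≤ s := by
  rcases le_or_gt s 0 with h0 | h0
  · rw [hh.updateExt_of_nonpos h0] at h1
    exact absurd hv.1 (not_lt.2 h1)
  rcases le_total s 1 with hs | hs
  · rw [updateExt_eq ⟨h0.le, hs⟩] at h1
    exact csInf_le (bddBelow_updateInv v) ⟨⟨h0.le, hs⟩, h1⟩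
  · exact (hh.updateInv_le_one hv.2).trans hs

theorem le_updateInv_of_lt {s v : ℝ} (hv : v ≤ 1) (h1 : updateExt h s < v) :
    s ≤ updateInv h v := by
  refine le_csInf (hh.nonempty_updateInv hv) fun u hu => ?_
  by_contra! hus
  have := hh.updateExt_mono hus.le
  rw [updateExt_eq hu.1] at this
  linarith [hu.2]

theorem updateInv_intervalIntegrable {s t : ℝ} (hs : s ≤ 1) (ht : t ≤ 1) :
    IntervalIntegrable (updateInv h) volume s t :=
  (hh.updateInv_monotoneOn.mono fun _ hx => hx.2.trans (max_le hs ht)).intervalIntegrable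

theorem updatePrim_sub {s t : ℝ} (hs : s ≤ 1) (ht : t ≤ 1) :
    updatePrim h t - updatePrim h s = ∫ v in s..t, updateInv h v :=
  intervalIntegral.integral_interval_sub_left (hh.updateInv_intervalIntegrable zero_le_one ht)
    (hh.updateInv_intervalIntegrable zero_le_one hs)

theorem updatePrim_monotoneOn : MonotoneOn (updatePrim h) (Iic 1) := by
  intro s hs t ht hst
  rw [← sub_nonneg, hh.updatePrim_sub hs ht]
  exact intervalIntegral.integral_nonneg hst fun v _ => updateInv_nonneg v

omit hh in
theorem updatePrim_zero : updatePrim h 0 = 0 := by simp [updatePrim]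

theorem updatePrim_mem_Icc {t : ℝ} (ht : t ∈ Icc (0 : ℝ) 1) : updatePrim h t ∈ Icc (0 : ℝ) 1 := by
  constructor
  · rw [← updatePrim_zero (h := h)]
    exact hh.updatePrim_monotoneOn (show (0 : ℝ) ≤ 1 from zero_le_one) ht.2 ht.1
  · calc updatePrim h t ≤ updatePrim h 1 := hh.updatePrim_monotoneOn ht.2 (le_refl (1 : ℝ)) ht.2
      _ ≤ ∫ _ in (0 : ℝ)..1, (1 : ℝ) := intervalIntegral.integral_mono_on zero_le_one
          (hh.updateInv_intervalIntegrable zero_le_one le_rfl) (by simp)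
          fun v hv => hh.updateInv_le_one hv.2
      _ = 1 := by simp

theorem updatePrim_comp_measurable {p : ℝ → ℝ} (hp : Monotone p) (hi : IsInterpolating p) :
    Measurable fun x => updatePrim h (p x) :=
  Monotone.measurable fun _ _ hxy =>
    hh.updatePrim_monotoneOn (hi.mem_Icc _).2 (hi.mem_Icc _).2 (hp hxy)

end IsUpdate

theorem updatePrim_eq_integral {h s : ℝ → ℝ} (hs : ∀ v ∈ Ioo (0 : ℝ) 1, updateInv h v = s v)
    {t : ℝ} (ht : t ∈ Icc (0 : ℝ) 1) :
    updatePrim h t = ∫ v, (if v ≤ t then s v else 0) ∂unitMeasure := by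
  have e : (fun v => if v ≤ t then s v else 0) = (Iic t).indicator s := by
    funext v
    simp [indicator]
  rw [e, updatePrim, intervalIntegral.integral_of_le ht.1, unitMeasure,
    Measure.restrict_congr_set Ioo_ae_eq_Ioc, setIntegral_indicator measurableSet_Iic,
    Ioc_inter_Iic, min_eq_right ht.2]
  have h1 : ∀ᵐ v : ℝ, v ≠ 1 := by simp [ae_iff]
  refine setIntegral_congr_ae measurableSet_Ioc ?_
  filter_upwards [h1] with v hv hv'
  exact hs v ⟨hv'.1, (hv'.2.trans ht.2).lt_of_ne hv⟩

/-- Along a profile consistent with the argument `s` of the update function, the generalized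
inverse is `s` at the quantile. -/
theorem updateInv_eq_of_consistent {h p a s : ℝ → ℝ} (hh : IsUpdate h) (ha : IsQuantile p a)
    (hs : Continuous s) (hc : ∀ x, ConsistentValue h (s x) (p x)) {v : ℝ} (hv : v ∈ Ioo (0 : ℝ) 1) :
    updateInv h v = s (a v) := by
  apply le_antisymm
  -- For `t > s (a v)`, continuity gives `y` just to the right of `a v` with `s y < t`; then `v ≤ p
  -- y ≤ h(s(y)+) ≤ h(t)`. The other inequality approaches `a v` from the left.
  · refine le_of_forall_gt_imp_ge_of_dense fun t ht => ?_
    have h1 : ∀ᶠ y in 𝓝[>] (a v), s y < t :=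
      (hs.tendsto (a v)).mono_left nhdsWithin_le_nhds (gt_mem_nhds ht)
    obtain ⟨y, hy, hay⟩ := (h1.and self_mem_nhdsWithin).exists
    refine hh.updateInv_le_of_le ⟨hv.1, hv.2.le⟩ ?_
    exact (ha.le_of_lt v hv y hay).trans ((hc y).2.trans (hh.updateExt_mono.rightLim_le hy))
  · refine le_of_forall_lt_imp_le_of_dense fun t ht => ?_
    have h1 : ∀ᶠ y in 𝓝[<] (a v), t < s y :=
      (hs.tendsto (a v)).mono_left nhdsWithin_le_nhds (lt_mem_nhds ht)
    obtain ⟨y, hy, hay⟩ := (h1.and self_mem_nhdsWithin).exists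
    refine hh.le_updateInv_of_lt hv.2.le ?_
    refine ((hh.updateExt_mono.le_leftLim hy).trans (hc y).1).trans_lt ?_
    by_contra! hle
    exact absurd (ha.le_of_le v hv y hle) (not_le.2 hay)

/-! ### The potential in quantile coordinates -/

/-- Lebesgue measure on `(0,1)²`. -/
abbrev squareMeasure : Measure (ℝ × ℝ) := unitMeasure.prod unitMeasure

/-- The integrand representing the uncoupled potential of a consistent pair whose quantile
functions differ by `d`. -/
def phiDensity (w : ℝ → ℝ) (d : ℝ) (P Q : Prop) [Decidable P] [Decidable Q] : ℝ :=
  (if P ∧ ¬ Q then windowCdf w d else 0) + (if Q ∧ ¬ P then 1 - windowCdf w d else 0)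

theorem phiDensity_nonneg {w : ℝ → ℝ} (hw : IsWindow w) (d : ℝ) (P Q : Prop) [Decidable P]
    [Decidable Q] : 0 ≤ phiDensity w d P Q := by
  have := hw.windowCdf_nonneg d
  have := hw.windowCdf_le_one d
  unfold phiDensity
  split_ifs <;> grind

theorem phiDensity_le_one {w : ℝ → ℝ} (hw : IsWindow w) (d : ℝ) (P Q : Prop) [Decidable P]
    [Decidable Q] : phiDensity w d P Q ≤ 1 := by
  have := hw.windowCdf_nonneg d
  have := hw.windowCdf_le_one d
  unfold phiDensity
  split_ifs <;> grind

theorem phiDensity_measurable {α : Type*} [MeasurableSpace α] {w : ℝ → ℝ} {d : α → ℝ} (hw : IsWindow w)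
    {P Q : α → Prop} [DecidablePred P] [DecidablePred Q] (hd : Measurable d)
    (hP : MeasurableSet {x | P x}) (hQ : MeasurableSet {x | Q x}) :
    Measurable fun x => phiDensity w (d x) (P x) (Q x) := by
  have hW := hw.windowCdf_continuous.measurable.comp hd
  exact (Measurable.ite (hP.inter hQ.compl) hW measurable_const).add
    (Measurable.ite (hQ.inter hP.compl) (measurable_const.sub hW) measurable_const)

/-! ### The uncoupled potential of a consistent pair -/

section phi

variable {w hf hg f g a b : ℝ → ℝ} (hw : IsWindow w)
  (hfi : IsInterpolating f) (hgi : IsInterpolating g) (ha : IsQuantile f a) (hb : IsQuantile g b)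
  (hfc : ∀ v ∈ Ioo (0 : ℝ) 1, updateInv hf v = smooth w g (a v))
  (hgc : ∀ u ∈ Ioo (0 : ℝ) 1, updateInv hg u = smooth w f (b u))
include hw hfi hgi ha hb hfc hgc

/-- With `P`, `Q` the indicators of `u ≤ u₀`, `v ≤ v₀`, the three terms of `φ` are the integrals of
`W(d) P`, `(1 - W(d)) Q` and `P Q`. Their combination is `W(d) P (1 - Q) + (1 - W(d)) Q (1 - P)`,
which has no negative part. -/
theorem phi_eq_integral {u₀ v₀ : ℝ} (hu : u₀ ∈ Icc (0 : ℝ) 1) (hv : v₀ ∈ Icc (0 : ℝ) 1) :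
    phi hf hg u₀ v₀ =
      ∫ z, phiDensity w (b z.1 - a z.2) (z.1 ≤ u₀) (z.2 ≤ v₀) ∂squareMeasure := by
  have hd : Measurable fun z : ℝ × ℝ => b z.1 - a z.2 :=
    (hb.measurable.comp measurable_fst).sub (ha.measurable.comp measurable_snd)
  have hW := hw.windowCdf_continuous.measurable.comp hd
  have hm1 : MeasurableSet {z : ℝ × ℝ | z.1 ≤ u₀} := measurableSet_le measurable_fst measurable_const
  have hm2 : MeasurableSet {z : ℝ × ℝ | z.2 ≤ v₀} := measurableSet_le measurable_snd measurable_const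
  have hi1 : Integrable (fun z : ℝ × ℝ => if z.1 ≤ u₀ then windowCdf w (b z.1 - a z.2) else 0)
      squareMeasure := by
    refine integrable_of_measurable_bound (Measurable.ite hm1 hW measurable_const) ?_ ?_ <;>
    · intro z
      have := hw.windowCdf_nonneg (b z.1 - a z.2)
      have := hw.windowCdf_le_one (b z.1 - a z.2)
      split_ifs <;> linarith
  have hi2 : Integrable (fun z : ℝ × ℝ => if z.2 ≤ v₀ then 1 - windowCdf w (b z.1 - a z.2) else 0)
      squareMeasure := by
    refine integrable_of_measurable_bound
      (Measurable.ite hm2 (measurable_const.sub hW) measurable_const) ?_ ?_ <;>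
    · intro z
      have := hw.windowCdf_nonneg (b z.1 - a z.2)
      have := hw.windowCdf_le_one (b z.1 - a z.2)
      split_ifs <;> linarith
  have hi12 : Integrable (fun z : ℝ × ℝ => (if z.1 ≤ u₀ then windowCdf w (b z.1 - a z.2) else 0) +
      (if z.2 ≤ v₀ then 1 - windowCdf w (b z.1 - a z.2) else 0)) squareMeasure := hi1.add hi2
  have hi3 : Integrable (fun z : ℝ × ℝ => (if z.1 ≤ u₀ then (1 : ℝ) else 0) *
      (if z.2 ≤ v₀ then 1 else 0)) squareMeasure := by
    refine integrable_of_measurable_bound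
      ((Measurable.ite hm1 measurable_const measurable_const).mul
        (Measurable.ite hm2 measurable_const measurable_const)) ?_ ?_ <;>
    · intro z
      split_ifs <;> norm_num
  have e : ∀ z : ℝ × ℝ, phiDensity w (b z.1 - a z.2) (z.1 ≤ u₀) (z.2 ≤ v₀) =
      (if z.1 ≤ u₀ then windowCdf w (b z.1 - a z.2) else 0) +
      (if z.2 ≤ v₀ then 1 - windowCdf w (b z.1 - a z.2) else 0) -
      (if z.1 ≤ u₀ then (1 : ℝ) else 0) * (if z.2 ≤ v₀ then 1 else 0) := by
    intro z
    unfold phiDensity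
    by_cases h1 : z.1 ≤ u₀ <;> by_cases h2 : z.2 ≤ v₀ <;> simp [h1, h2]
  simp only [e]
  rw [integral_sub hi12 hi3, integral_add hi1 hi2, integral_prod _ hi1,
    integral_prod_symm _ hi2,
    integral_prod_mul (fun u => if u ≤ u₀ then (1 : ℝ) else 0) (fun v => if v ≤ v₀ then (1 : ℝ) else 0),
    integral_unitMeasure_le hu, integral_unitMeasure_le hv, phi,
    updatePrim_eq_integral hfc hv, updatePrim_eq_integral hgc hu]
  congr 2
  · congr 1
    funext u
    split_ifs
    · exact ha.smooth_eq hfi hw _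
    · simp
  · congr 1
    funext v
    split_ifs
    · rw [hb.smooth_eq hgi hw]
      congr 1
      funext u
      -- Evenness of `w` turns `W(a - b)` into `1 - W(b - a)`, so both inverses use the same
      -- difference `d`.
      exact hw.windowCdf_sub_comm _ _
    · simp

theorem phi_nonneg {u₀ v₀ : ℝ} (hu : u₀ ∈ Icc (0 : ℝ) 1) (hv : v₀ ∈ Icc (0 : ℝ) 1) :
    0 ≤ phi hf hg u₀ v₀ := by
  rw [phi_eq_integral hw hfi hgi ha hb hfc hgc hu hv]
  exact integral_nonneg fun z => phiDensity_nonneg hw _ _ _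

/-- The uncoupled part of the potential of a pair `(f', g')`, in the quantile coordinates of a
consistent pair. -/
theorem lintegral_phi {f' g' a' b' : ℝ → ℝ} (hfi' : IsInterpolating f') (hgi' : IsInterpolating g')
    (ha' : IsQuantile f' a') (hb' : IsQuantile g' b') :
    ∫⁻ x, ENNReal.ofReal (phi hf hg (g' x) (f' x)) =
      ∫⁻ z, ENNReal.ofReal (max (b' z.1 - a' z.2) 0 -
        windowCdf w (b z.1 - a z.2) * (b' z.1 - a' z.2)) ∂squareMeasure := by
  have hd : Measurable fun z : ℝ × ℝ => b z.1 - a z.2 :=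
    (hb.measurable.comp measurable_fst).sub (ha.measurable.comp measurable_snd)
  have h1 : ∀ᵐ x, ENNReal.ofReal (phi hf hg (g' x) (f' x)) = ∫⁻ z, ENNReal.ofReal
      (phiDensity w (b z.1 - a z.2) (b' z.1 ≤ x) (a' z.2 ≤ x)) ∂squareMeasure := by
    filter_upwards [ha'.ae_le_iff, hb'.ae_le_iff] with x hx hy
    rw [phi_eq_integral hw hfi hgi ha hb hfc hgc (hgi'.mem_Icc x) (hfi'.mem_Icc x),
      ofReal_integral_eq_lintegral_ofReal _ (ae_of_all _ fun z => phiDensity_nonneg hw _ _ _)]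
    · refine lintegral_congr_ae ?_
      filter_upwards [Measure.quasiMeasurePreserving_fst.ae hy,
        Measure.quasiMeasurePreserving_snd.ae hx] with z hz1 hz2
      simp only [hz1, hz2]
    · exact integrable_of_measurable_bound (phiDensity_measurable hw hd
        (measurableSet_le measurable_fst measurable_const)
        (measurableSet_le measurable_snd measurable_const)) (fun _ => phiDensity_nonneg hw _ _ _)
        fun _ => phiDensity_le_one hw _ _ _
  rw [lintegral_congr_ae h1, lintegral_lintegral_swap]
  · refine lintegral_congr fun z => ?_
    generalize b z.1 - a z.2 = d
    generalize b' z.1 = β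
    generalize a' z.2 = α
    have hW0 := hw.windowCdf_nonneg d
    have hW1 := hw.windowCdf_le_one d
    -- In `x`, the density lives on the interval between the two competitor quantiles, with weight
    -- `W(d)` or `1 - W(d)` according to their order; its total mass is `max e 0 - W(d) e` for `e =
    -- β - α`.
    have e : ∀ x, ENNReal.ofReal (phiDensity w d (β ≤ x) (α ≤ x)) =
        (Ico β α).indicator (fun _ => ENNReal.ofReal (windowCdf w d)) x +
        (Ico α β).indicator (fun _ => ENNReal.ofReal (1 - windowCdf w d)) x := by
      intro x
      simp only [phiDensity, indicator, mem_Ico, not_le]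
      split_ifs <;> first | (exfalso; grind) | simp
    simp only [e]
    rw [lintegral_add_left (measurable_const.indicator measurableSet_Ico),
      lintegral_indicator_const measurableSet_Ico, lintegral_indicator_const measurableSet_Ico,
      Real.volume_Ico, Real.volume_Ico]
    rcases le_total α β with h | h
    · rw [ENNReal.ofReal_of_nonpos (sub_nonpos.2 h), mul_zero, zero_add,
        ← ENNReal.ofReal_mul (by linarith), max_eq_left (by linarith)]
      congr 1
      ring
    · rw [ENNReal.ofReal_of_nonpos (sub_nonpos.2 h), mul_zero, add_zero,
        ← ENNReal.ofReal_mul (by linarith), max_eq_right (by linarith)]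
      congr 1
      ring
  · refine (ENNReal.measurable_ofReal.comp (phiDensity_measurable hw (hd.comp measurable_snd)
      ?_ ?_)).aemeasurable
    · exact measurableSet_le (hb'.measurable.comp (measurable_fst.comp measurable_snd)) measurable_fst
    · exact measurableSet_le (ha'.measurable.comp (measurable_snd.comp measurable_snd)) measurable_fst

end phi

/-! ### The potential of an arbitrary pair -/

theorem integrable_intervalIntegral_of_bound {F : ℝ → ℝ} (hF : Measurable F) {C : ℝ}
    (hC : ∀ x, ‖F x‖ ≤ C) (s t : ℝ) : IntervalIntegrable F volume s t :=
  (intervalIntegrable_const (c := C)).mono_fun' hF.aestronglyMeasurable (ae_of_all _ hC)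

/-- The truncation box `[-A, B]` exhausts the line as `A, B → ∞`. -/
theorem tendsto_neg_fst : Tendsto (fun AB : ℝ × ℝ => -AB.1) (atTop ×ˢ atTop) atBot :=
  tendsto_neg_atTop_atBot.comp tendsto_fst

theorem tendsto_coe_intervalIntegral {F : ℝ → ℝ} (hF : Measurable F) (h0 : ∀ x, 0 ≤ F x) {C : ℝ}
    (hC : ∀ x, F x ≤ C) :
    Tendsto (fun AB : ℝ × ℝ => ((∫ x in (-AB.1)..AB.2, F x : ℝ) : EReal)) (atTop ×ˢ atTop)
      (𝓝 ((∫⁻ x, ENNReal.ofReal (F x) : ENNReal) : EReal)) := by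
  have h1 := (aecover_Ioc (μ := volume) tendsto_neg_fst
    tendsto_snd).lintegral_tendsto_of_countably_generated
    (ENNReal.measurable_ofReal.comp hF).aemeasurable
  refine ((continuous_coe_ennreal_ereal.tendsto _).comp h1).congr' ?_
  filter_upwards [(eventually_ge_atTop (0 : ℝ)).prod_mk (eventually_ge_atTop (0 : ℝ))]
    with AB hAB
  have hle : -AB.1 ≤ AB.2 := by linarith [hAB.1, hAB.2]
  have hi := (integrable_intervalIntegral_of_bound hF
    (fun x => by rw [Real.norm_of_nonneg (h0 x)]; exact hC x) (-AB.1) AB.2)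
  rw [intervalIntegrable_iff_integrableOn_Ioc_of_le hle] at hi
  have h2 := ofReal_integral_eq_lintegral_ofReal hi (ae_of_all _ h0)
  simp only [Function.comp_apply]
  rw [intervalIntegral.integral_of_le hle, ← h2, EReal.coe_ennreal_ofReal, max_eq_left]
  exact integral_nonneg h0

section potential

variable {w hf hg f g a b : ℝ → ℝ} (hw : IsWindow w) (hhf : IsUpdate hf) (hhg : IsUpdate hg)
  (hfm : Monotone f) (hgm : Monotone g) (hfi : IsInterpolating f) (hgi : IsInterpolating g)

/-- Here `f - f^w` is the mixture of step defects centred at `a(v)`, and `g` is the mixture of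
indicators of `[b(u), ∞)`. Integrating over `x` first leaves the tail `K(b(u) - a(v))`. -/
theorem integrable_interaction (hw : IsWindow w) (hfi : IsInterpolating f)
    (hgi : IsInterpolating g) (ha : IsQuantile f a) (hb : IsQuantile g b) :
    Integrable (fun x => (f x - smooth w f x) * g x) ∧
      ∫ x, (f x - smooth w f x) * g x =
        ∫ z, stepDefectTail w (b z.1 - a z.2) ∂squareMeasure := by
  let F : ℝ × (ℝ × ℝ) → ℝ := fun y =>
    (if b y.2.1 ≤ y.1 then (1 : ℝ) else 0) * stepDefect w (y.1 - a y.2.2)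
  have hmk : Measurable fun y : ℝ × (ℝ × ℝ) => stepDefect w (y.1 - a y.2.2) :=
    hw.stepDefect_measurable.comp (measurable_fst.sub
      (ha.measurable.comp (measurable_snd.comp measurable_snd)))
  have hmF : Measurable F := Measurable.mul (Measurable.ite (measurableSet_le
    (hb.measurable.comp (measurable_fst.comp measurable_snd)) measurable_fst)
    measurable_const measurable_const) hmk
  have hFint : Integrable F (volume.prod squareMeasure) := by
    have hk : Integrable (fun y : ℝ × (ℝ × ℝ) => stepDefect w (y.1 - a y.2.2))
        (volume.prod squareMeasure) := by
      rw [integrable_prod_iff' hmk.aestronglyMeasurable]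
      refine ⟨ae_of_all _ fun z => hw.stepDefect_integrable.comp_sub_right (a z.2), ?_⟩
      have : ∀ z : ℝ × ℝ, ∫ x, ‖stepDefect w (x - a z.2)‖ = ∫ x, ‖stepDefect w x‖ := fun z =>
        integral_sub_right_eq_self (fun x => ‖stepDefect w x‖) (a z.2)
      simp only [this]
      exact integrable_const _
    refine hk.norm.mono' hmF.aestronglyMeasurable (ae_of_all _ fun y => ?_)
    simp only [F, norm_mul]
    refine mul_le_of_le_one_left (norm_nonneg _) ?_
    split_ifs <;> simp
  have hx : ∀ᵐ x, ∫ z, F (x, z) ∂squareMeasure = (f x - smooth w f x) * g x := by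
    filter_upwards [ha.ae_eq_integral hfi, hb.ae_eq_integral hgi] with x hxf hxg
    simp only [F]
    rw [integral_prod_mul (fun u => if b u ≤ x then (1 : ℝ) else 0)
      (fun v => stepDefect w (x - a v)), ← hxg, mul_comm]
    congr 1
    rw [ha.smooth_eq hfi hw, hxf, ← integral_sub]
    · simp only [stepDefect, sub_nonneg]
    · refine integrable_of_measurable_bound (Measurable.ite (measurableSet_le ha.measurable
        measurable_const) measurable_const measurable_const) ?_ ?_ <;>
      · intro v
        split_ifs <;> norm_num
    · exact integrable_of_measurable_bound (hw.windowCdf_continuous.measurable.comp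
        (measurable_const.sub ha.measurable)) (fun _ => hw.windowCdf_nonneg _)
        fun _ => hw.windowCdf_le_one _
  refine ⟨hFint.integral_prod_left.congr hx, ?_⟩
  rw [← integral_congr_ae hx, integral_integral_swap hFint]
  refine integral_congr_ae (ae_of_all _ fun z => ?_)
  have e : (fun x => F (x, z)) =
      fun x => (Ici (b z.1 - a z.2)).indicator (stepDefect w) (x - a z.2) := by
    funext x
    simp [F, indicator]
  simp only [e]
  rw [integral_sub_right_eq_self (fun x => (Ici (b z.1 - a z.2)).indicator (stepDefect w) x),
    integral_indicator measurableSet_Ici]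
  rfl

include hw hhf hhg hfm hgm hfi hgi in
-- The integrand is `φ(g,f) + (f - f^w) g`. The first term is nonnegative, so its integral converges
-- in `[0,∞]`; the second is integrable, so the sum in `EReal` is never of the form `∞ - ∞`.
theorem tendsto_truncatedPotential (ha : IsQuantile f a) (hb : IsQuantile g b)
    (hphi : ∀ u ∈ Icc (0 : ℝ) 1, ∀ v ∈ Icc (0 : ℝ) 1, 0 ≤ phi hf hg u v) :
    Tendsto (truncatedPotential w hf hg f g) (atTop ×ˢ atTop)
      (𝓝 (((∫⁻ x, ENNReal.ofReal (phi hf hg (g x) (f x)) : ENNReal) : EReal) +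
        ((∫ z, stepDefectTail w (b z.1 - a z.2) ∂squareMeasure : ℝ) : EReal))) := by
  obtain ⟨hint, heq⟩ := integrable_interaction hw hfi hgi ha hb
  have hm : Measurable fun x => phi hf hg (g x) (f x) :=
    ((hhg.updatePrim_comp_measurable hgm hgi).add (hhf.updatePrim_comp_measurable hfm hfi)).sub
      (hgm.measurable.mul hfm.measurable)
  have h0 : ∀ x, 0 ≤ phi hf hg (g x) (f x) := fun x => hphi _ (hgi.mem_Icc x) _ (hfi.mem_Icc x)
  have h2 : ∀ x, phi hf hg (g x) (f x) ≤ 2 := by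
    intro x
    have h3 := (hhg.updatePrim_mem_Icc (hgi.mem_Icc x)).2
    have h4 := (hhf.updatePrim_mem_Icc (hfi.mem_Icc x)).2
    have h5 := mul_nonneg (hgi.mem_Icc x).1 (hfi.mem_Icc x).1
    unfold phi
    linarith
  have ht1 := tendsto_coe_intervalIntegral hm h0 h2
  have ht2 := (continuous_coe_real_ereal.tendsto _).comp
    (intervalIntegral_tendsto_integral hint tendsto_neg_fst (tendsto_snd (g := atTop)))
  rw [heq] at ht2
  refine ((EReal.continuousAt_add (Or.inr (EReal.coe_ne_bot _)) (Or.inr (EReal.coe_ne_top _))).tendsto.comp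
    (ht1.prodMk_nhds ht2)).congr fun AB => ?_
  simp only [Function.comp_apply, truncatedPotential]
  rw [← EReal.coe_add, ← intervalIntegral.integral_add
    (integrable_intervalIntegral_of_bound hm
      (fun x => by rw [Real.norm_of_nonneg (h0 x)]; exact h2 x) _ _) hint.intervalIntegrable]
  congr 2
  funext x
  simp only [phi, potentialIntegrand]
  ring

end potential

/-! ### Sufficiency: consistent pairs are minimal -/

/-- Serves to integrate the pointwise convexity inequality when the competitor's potential may be
infinite. If it is finite, `p ≤ q + l - k` makes `p` integrable and ordinary monotonicity applies.
-/
theorem lintegral_add_integral_le {α : Type*} [MeasurableSpace α] {μ : Measure α}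
    {p q k l : α → ℝ} (hp : Measurable p) (hq : Measurable q) (hp0 : ∀ x, 0 ≤ p x)
    (hq0 : ∀ x, 0 ≤ q x) (hk : Integrable k μ) (hl : Integrable l μ)
    (hle : ∀ x, p x + k x ≤ q x + l x) :
    ((∫⁻ x, ENNReal.ofReal (p x) ∂μ : ENNReal) : EReal) + ((∫ x, k x ∂μ : ℝ) : EReal) ≤
      ((∫⁻ x, ENNReal.ofReal (q x) ∂μ : ENNReal) : EReal) + ((∫ x, l x ∂μ : ℝ) : EReal) := by
  rcases eq_or_ne (∫⁻ x, ENNReal.ofReal (q x) ∂μ) ⊤ with htop | hfin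
  · rw [htop, EReal.coe_ennreal_top, EReal.top_add_coe]
    exact le_top
  have hqi : Integrable q μ :=
    (lintegral_ofReal_ne_top_iff_integrable hq.aestronglyMeasurable (ae_of_all _ hq0)).1 hfin
  have hpi : Integrable p μ := by
    refine Integrable.mono' ((hqi.add hl).sub hk) hp.aestronglyMeasurable (ae_of_all _ fun x => ?_)
    rw [Real.norm_of_nonneg (hp0 x)]
    simp only [Pi.sub_apply, Pi.add_apply]
    linarith [hle x]
  rw [← ofReal_integral_eq_lintegral_ofReal hpi (ae_of_all _ hp0),
    ← ofReal_integral_eq_lintegral_ofReal hqi (ae_of_all _ hq0), EReal.coe_ennreal_ofReal,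
    EReal.coe_ennreal_ofReal, max_eq_left (integral_nonneg hp0), max_eq_left (integral_nonneg hq0),
    ← EReal.coe_add, ← EReal.coe_add, EReal.coe_le_coe_iff, ← integral_add hpi hk,
    ← integral_add hqi hl]
  exact integral_mono (hpi.add hk) (hqi.add hl) hle

theorem IsCFP.isMinimalPair {w hf hg f g : ℝ → ℝ} (hw : IsWindow w)
    (hhf : IsUpdate hf) (hhg : IsUpdate hg) (hfm : Monotone f) (hgm : Monotone g)
    (hfi : IsInterpolating f) (hgi : IsInterpolating g) (h : IsCFP w hf hg f g) :
    IsMinimalPair w hf hg f g := by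
  obtain ⟨a, ha⟩ := exists_isQuantile hfm hfi
  obtain ⟨b, hb⟩ := exists_isQuantile hgm hgi
  have hfc : ∀ v ∈ Ioo (0 : ℝ) 1, updateInv hf v = smooth w g (a v) := fun v hv =>
    updateInv_eq_of_consistent hhf ha (smooth_continuous hw hgm hgi) h.1 hv
  have hgc : ∀ u ∈ Ioo (0 : ℝ) 1, updateInv hg u = smooth w f (b u) := fun v hv =>
    updateInv_eq_of_consistent hhg hb (smooth_continuous hw hfm hfi) h.2 hv
  have hphi : ∀ u ∈ Icc (0 : ℝ) 1, ∀ v ∈ Icc (0 : ℝ) 1, 0 ≤ phi hf hg u v := fun u hu v hv =>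
    phi_nonneg hw hfi hgi ha hb hfc hgc hu hv
  have hlim := tendsto_truncatedPotential hw hhf hhg hfm hgm hfi hgi ha hb hphi
  have hpot := potential_eq_of_tendsto hlim
  refine ⟨hpot ▸ hlim, ?_, fun f' g' hfm' hgm' hfi' hgi' => ?_⟩
  · rw [hpot]
    exact EReal.add_ne_bot_iff.2 ⟨EReal.coe_ennreal_ne_bot _, EReal.coe_ne_bot _⟩
  obtain ⟨a', ha'⟩ := exists_isQuantile hfm' hfi'
  obtain ⟨b', hb'⟩ := exists_isQuantile hgm' hgi'
  rw [hpot, potential_eq_of_tendsto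
    (tendsto_truncatedPotential hw hhf hhg hfm' hgm' hfi' hgi' ha' hb' hphi),
    lintegral_phi hw hfi hgi ha hb hfc hgc hfi hgi ha hb,
    lintegral_phi hw hfi hgi ha hb hfc hgc hfi' hgi' ha' hb']
  have hd : Measurable fun z : ℝ × ℝ => b z.1 - a z.2 :=
    (hb.measurable.comp measurable_fst).sub (ha.measurable.comp measurable_snd)
  have hd' : Measurable fun z : ℝ × ℝ => b' z.1 - a' z.2 :=
    (hb'.measurable.comp measurable_fst).sub (ha'.measurable.comp measurable_snd)
  have hW := hw.windowCdf_continuous.measurable.comp hd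
  have hK : ∀ {d : ℝ × ℝ → ℝ}, Measurable d →
      Integrable (fun z => stepDefectTail w (d z)) squareMeasure := fun hd =>
    Integrable.of_bound (hw.stepDefectTail_continuous.measurable.comp hd).aestronglyMeasurable _
      (ae_of_all _ fun z => hw.abs_stepDefectTail_le _)
  have hnonneg : ∀ d e : ℝ, 0 ≤ max e 0 - windowCdf w d * e := by
    intro d e
    have h0 := hw.windowCdf_nonneg d
    have h1 := hw.windowCdf_le_one d
    rcases le_total 0 e with he | he
    · rw [max_eq_left he]
      nlinarith
    · rw [max_eq_right he]
      nlinarith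
  -- The tangent inequality at `d = b(u) - a(v)`, applied at each point of the square.
  exact lintegral_add_integral_le ((hd.max measurable_const).sub (hW.mul hd))
    ((hd'.max measurable_const).sub (hW.mul hd')) (fun _ => hnonneg _ _) (fun _ => hnonneg _ _)
    (hK hd) (hK hd') fun z => hw.posPart_add_tail_convex _ _

/-! ### First variation of the potential -/

theorem integrable_of_bound_of_support {F : ℝ → ℝ} (hF : Measurable F) {C N : ℝ}
    (hC : ∀ x, ‖F x‖ ≤ C) (hN : ∀ x, N < |x| → F x = 0) : Integrable F := by
  have h : IntegrableOn F (Icc (-N) N) :=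
    Integrable.of_bound hF.aestronglyMeasurable C (ae_of_all _ hC)
  refine (integrableOn_iff_integrable_of_support_subset fun x hx => ?_).1 h
  by_contra hx'
  exact hx (hN x (by rwa [mem_Icc, ← abs_le, not_le] at hx'))

/-- For two unit steps at `0`, `φ(1,1) = 0` cancels the uncoupled part on the right half-line,
leaving the integrable defect `1 - W` there and zero on the left. -/
theorem exists_potential_ne_top {w hf hg : ℝ → ℝ} (hw : IsWindow w) (hphi : phi hf hg 1 1 = 0) :
    ∃ p : ℝ → ℝ, Monotone p ∧ IsInterpolating p ∧ potential w hf hg p p ≠ ⊤ := by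
  let p : ℝ → ℝ := fun x => if 0 ≤ x then 1 else 0
  have hpm : Monotone p := by
    intro x y hxy
    simp only [p]
    split_ifs <;> linarith
  have hpi : IsInterpolating p := by
    refine ⟨fun x => ?_, ?_, ?_⟩
    · simp only [p]
      split_ifs <;> simp
    · refine tendsto_const_nhds.congr' ?_
      filter_upwards [eventually_lt_atBot 0] with x hx
      simp [p, hx]
    · refine tendsto_const_nhds.congr' ?_
      filter_upwards [eventually_ge_atTop 0] with x hx
      simp [p, hx]
  have hq : IsQuantile p 0 := by
    refine ⟨measurable_const, fun v hv x hx => ?_, fun v hv x hx => ?_⟩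
    · by_contra! h
      have : p x = 0 := if_neg (not_le.2 h)
      linarith [hv.1]
    · have : p x = 1 := if_pos (le_of_lt hx)
      linarith [hv.2]
  have hI : potentialIntegrand w hf hg p p = (Ici 0).indicator (stepDefect w) := by
    funext x
    have hs : smooth w p x = windowCdf w x := by
      rw [hq.smooth_eq hpi hw]
      simp
    rw [potentialIntegrand, hs]
    unfold phi at hphi
    by_cases hx : 0 ≤ x
    · have : p x = 1 := if_pos hx
      rw [this, indicator_of_mem (show x ∈ Ici (0 : ℝ) from hx), stepDefect, if_pos hx]
      linarith
    · have : p x = 0 := if_neg hx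
      rw [this, indicator_of_notMem (show x ∉ Ici (0 : ℝ) from hx), IsUpdate.updatePrim_zero,
        IsUpdate.updatePrim_zero]
      ring
  have hint : Integrable (potentialIntegrand w hf hg p p) := by
    rw [hI]
    exact hw.stepDefect_integrable.indicator measurableSet_Ici
  refine ⟨p, hpm, hpi, ?_⟩
  rw [potential_eq_of_tendsto ((continuous_coe_real_ereal.tendsto _).comp
    (intervalIntegral_tendsto_integral hint tendsto_neg_fst (tendsto_snd (g := atTop))))]
  exact EReal.coe_ne_top _

/-- The minimum is a real number, so convergence of the difference of truncated potentials makes the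
competitor's potential a genuine limit, namely the minimum plus `e`. -/
theorem IsMinimalPair.nonneg_of_tendsto {w hf hg f g f' g' : ℝ → ℝ} (hw : IsWindow w)
    (hphi : phi hf hg 1 1 = 0) (h : IsMinimalPair w hf hg f g) (hfm' : Monotone f')
    (hgm' : Monotone g') (hfi' : IsInterpolating f') (hgi' : IsInterpolating g') {e : ℝ}
    (he : Tendsto (fun AB : ℝ × ℝ => (∫ x in (-AB.1)..AB.2, potentialIntegrand w hf hg f' g' x) -
      ∫ x in (-AB.1)..AB.2, potentialIntegrand w hf hg f g x) (atTop ×ˢ atTop) (𝓝 e)) :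
    0 ≤ e := by
  obtain ⟨hlim, hbot, hmin⟩ := h
  obtain ⟨p, hpm, hpi, hp⟩ := exists_potential_ne_top hw hphi
  have htop : potential w hf hg f g ≠ ⊤ :=
    ((hmin p p hpm hpm hpi hpi).trans_lt (lt_top_iff_ne_top.2 hp)).ne
  obtain ⟨r, hr⟩ : ∃ r : ℝ, (r : EReal) = potential w hf hg f g :=
    ⟨_, EReal.coe_toReal htop hbot⟩
  have hle := hmin f' g' hfm' hgm' hfi' hgi'
  rw [← hr] at hlim hle
  have hlim' := EReal.tendsto_coe.1 hlim
  have hsum := (hlim'.add he).congr fun AB => add_sub_cancel _ _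
  rw [potential_eq_of_tendsto (EReal.tendsto_coe.2 hsum), EReal.coe_le_coe_iff] at hle
  linarith

theorem abs_sub_le_one_of_mem_Icc {x y : ℝ} (hx : x ∈ Icc (0 : ℝ) 1) (hy : y ∈ Icc (0 : ℝ) 1) :
    ‖x - y‖ ≤ 1 :=
  abs_le.2 ⟨by linarith [hx.1, hy.2], by linarith [hx.2, hy.1]⟩

section variation

variable {w hf hg f g p : ℝ → ℝ} {N : ℝ} (hw : IsWindow w) (hhf : IsUpdate hf) (hhg : IsUpdate hg)
  (hphi : phi hf hg 1 1 = 0) (hfm : Monotone f) (hgm : Monotone g)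
  (hfi : IsInterpolating f) (hgi : IsInterpolating g)
  (hpm : Monotone p) (hpi : IsInterpolating p)

theorem integrable_updatePrim_sub {h : ℝ → ℝ} (hh : IsUpdate h) (hfm : Monotone f)
    (hfi : IsInterpolating f) (hpm : Monotone p) (hpi : IsInterpolating p)
    (hN : ∀ x, N < |x| → p x = f x) :
    Integrable fun x => updatePrim h (p x) - updatePrim h (f x) :=
  integrable_of_bound_of_support
    ((hh.updatePrim_comp_measurable hpm hpi).sub (hh.updatePrim_comp_measurable hfm hfi))
    (fun x => abs_sub_le_one_of_mem_Icc (hh.updatePrim_mem_Icc (hpi.mem_Icc x))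
      (hh.updatePrim_mem_Icc (hfi.mem_Icc x))) fun x hx => by rw [hN x hx, sub_self]

theorem integrable_sub (hfm : Monotone f)
    (hfi : IsInterpolating f) (hpm : Monotone p) (hpi : IsInterpolating p)
    (hN : ∀ x, N < |x| → p x = f x) : Integrable fun x => p x - f x :=
  integrable_of_bound_of_support (hpm.measurable.sub hfm.measurable)
    (fun x => abs_sub_le_one_of_mem_Icc (hpi.mem_Icc x) (hfi.mem_Icc x))
    fun x hx => by rw [hN x hx, sub_self]

theorem integrable_sub_mul_smooth (hw : IsWindow w) (hfm : Monotone f)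
    (hfi : IsInterpolating f) (hgm : Monotone g) (hgi : IsInterpolating g)
    (hpm : Monotone p) (hpi : IsInterpolating p)
    (hN : ∀ x, N < |x| → p x = f x) : Integrable fun x => (p x - f x) * smooth w g x :=
  (integrable_sub hfm hfi hpm hpi hN).mul_bdd (c := 1)
    (smooth_continuous hw hgm hgi).aestronglyMeasurable (ae_of_all _ fun x => by
      rw [Real.norm_of_nonneg (smooth_mem_Icc hw hgm hgi x).1]
      exact (smooth_mem_Icc hw hgm hgi x).2)

include hw hfm hgm hfi hgi hpm hpi in
-- Smoothing by an even kernel is self-adjoint. This makes the variation in `f` symmetric to the one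
-- in `g`, although the potential smooths only `f`.
theorem integral_smooth_sub_mul (hN : ∀ x, N < |x| → p x = f x) :
    Integrable (fun x => (smooth w p x - smooth w f x) * g x) ∧
      ∫ x, (smooth w p x - smooth w f x) * g x = ∫ x, (p x - f x) * smooth w g x := by
  have hr := integrable_sub hfm hfi hpm hpi hN
  have hF : Integrable (fun z : ℝ × ℝ => (p z.2 - f z.2) * w (z.1 - z.2) * g z.1)
      (volume.prod volume) := by
    have h1 := hr.convolution_integrand (ContinuousLinearMap.mul ℝ ℝ) hw.integrable
    refine Integrable.mul_bdd (c := 1) h1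
      (hgm.measurable.comp measurable_fst).aestronglyMeasurable (ae_of_all _ fun z => ?_)
    rw [Real.norm_of_nonneg (hgi.mem_Icc z.1).1]
    exact (hgi.mem_Icc z.1).2
  have hmul : ∀ {q : ℝ → ℝ}, Monotone q → IsInterpolating q → ∀ x,
      Integrable fun t => q t * w (x - t) := fun hqm hqi x =>
    (hw.integrable.comp_sub_left x).bdd_mul (c := 1) hqm.measurable.aestronglyMeasurable
      (ae_of_all _ fun t => by
        rw [Real.norm_of_nonneg (hqi.mem_Icc t).1]
        exact (hqi.mem_Icc t).2)
  have h1 : ∀ x, ∫ t, (p t - f t) * w (x - t) * g x = (smooth w p x - smooth w f x) * g x := by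
    intro x
    rw [integral_mul_const]
    congr 1
    simp only [sub_mul]
    exact integral_sub (hmul hpm hpi x) (hmul hfm hfi x)
  have h2 : ∀ t, ∫ x, (p t - f t) * w (x - t) * g x = (p t - f t) * smooth w g t := by
    intro t
    simp only [mul_assoc]
    rw [integral_const_mul]
    congr 1
    refine integral_congr_ae (ae_of_all _ fun x => ?_)
    show w (x - t) * g x = g x * w (t - x)
    rw [← hw.even, neg_sub, mul_comm]
  refine ⟨hF.integral_prod_left.congr (ae_of_all _ h1), ?_⟩
  simp only [← h1, ← h2]
  exact integral_integral_swap hF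

include hw hhf hhg hfm hgm hfi hgi in
theorem potentialIntegrand_intervalIntegrable (s t : ℝ) :
    IntervalIntegrable (potentialIntegrand w hf hg f g) volume s t := by
  refine integrable_intervalIntegral_of_bound (C := 2)
    (((hhg.updatePrim_comp_measurable hgm hgi).add (hhf.updatePrim_comp_measurable hfm hfi)).sub
      ((smooth_continuous hw hfm hfi).measurable.mul hgm.measurable)) (fun x => ?_) s t
  have h1 := hhg.updatePrim_mem_Icc (hgi.mem_Icc x)
  have h2 := hhf.updatePrim_mem_Icc (hfi.mem_Icc x)
  have h3 := smooth_mem_Icc hw hfm hfi x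
  have h4 := hgi.mem_Icc x
  have h5 := mul_nonneg h3.1 h4.1
  have h6 := mul_le_one₀ h3.2 h4.1 h4.2
  simp only [Pi.sub_apply, Pi.add_apply, Pi.mul_apply]
  exact abs_le.2 ⟨by linarith [h1.1, h2.1], by linarith [h1.2, h2.2]⟩

include hw hhf hhg hphi hfm hgm hfi hgi hpm hpi

theorem IsMinimalPair.variation_right (h : IsMinimalPair w hf hg f g)
    (hN : ∀ x, N < |x| → p x = g x) :
    0 ≤ ∫ x, (updatePrim hg (p x) - updatePrim hg (g x) - (p x - g x) * smooth w f x) := by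
  refine h.nonneg_of_tendsto hw hphi hfm hpm hfi hpi ?_
  refine (intervalIntegral_tendsto_integral ((integrable_updatePrim_sub hhg hgm hgi hpm hpi hN).sub
    (integrable_sub_mul_smooth hw hgm hgi hfm hfi hpm hpi hN)) tendsto_neg_fst
    (tendsto_snd (g := atTop))).congr fun AB => ?_
  rw [← intervalIntegral.integral_sub
    (potentialIntegrand_intervalIntegrable hw hhf hhg hfm hpm hfi hpi _ _)
    (potentialIntegrand_intervalIntegrable hw hhf hhg hfm hgm hfi hgi _ _)]
  congr 1
  funext x
  simp only [potentialIntegrand, Pi.sub_apply]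
  ring

theorem IsMinimalPair.variation_left (h : IsMinimalPair w hf hg f g)
    (hN : ∀ x, N < |x| → p x = f x) :
    0 ≤ ∫ x, (updatePrim hf (p x) - updatePrim hf (f x) - (p x - f x) * smooth w g x) := by
  refine h.nonneg_of_tendsto hw hphi hpm hgm hpi hgi ?_
  have h1 := integrable_updatePrim_sub hhf hfm hfi hpm hpi hN
  obtain ⟨h2, h3⟩ := integral_smooth_sub_mul hw hfm hgm hfi hgi hpm hpi hN
  rw [integral_sub h1 (integrable_sub_mul_smooth hw hfm hfi hgm hgi hpm hpi hN), ← h3,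
    ← integral_sub h1 h2]
  refine (intervalIntegral_tendsto_integral (h1.sub h2) tendsto_neg_fst
    (tendsto_snd (g := atTop))).congr fun AB => ?_
  rw [← intervalIntegral.integral_sub
    (potentialIntegrand_intervalIntegrable hw hhf hhg hpm hgm hpi hgi _ _)
    (potentialIntegrand_intervalIntegrable hw hhf hhg hfm hgm hfi hgi _ _)]
  congr 1
  funext x
  simp only [potentialIntegrand, Pi.sub_apply]
  ring

end variation

/-! ### Stationary profiles are consistent -/

namespace IsUpdate

variable {h : ℝ → ℝ} (hh : IsUpdate h)
include hh

/-- If `h(σ) < c`, then `h⁻¹ ≥ σ` on levels from `c` upwards, so the primitive has slope at least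
`σ` there. -/
theorem mul_sub_le_updatePrim_sub {c σ r t : ℝ} (hσ : updateExt h σ < c) (hcr : c ≤ r)
    (hrt : r ≤ t) (ht : t ≤ 1) : σ * (t - r) ≤ updatePrim h t - updatePrim h r := by
  rw [hh.updatePrim_sub (hrt.trans ht) ht]
  calc σ * (t - r) = ∫ _ in r..t, σ := by simp [mul_comm]
    _ ≤ _ := intervalIntegral.integral_mono_on hrt (by simp)
      (hh.updateInv_intervalIntegrable (hrt.trans ht) ht) fun v hv =>
        hh.le_updateInv_of_lt (hv.2.trans ht) (hσ.trans_le (hcr.trans hv.1))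

theorem updatePrim_sub_le_mul_sub {c σ r t : ℝ} (hσ : c < updateExt h σ) (hr : 0 ≤ r)
    (hrt : r ≤ t) (htc : t ≤ c) : updatePrim h t - updatePrim h r ≤ σ * (t - r) := by
  have ht : t ≤ 1 := htc.trans (hσ.le.trans (hh.updateExt_mem_Icc σ).2)
  rw [hh.updatePrim_sub (hrt.trans ht) ht]
  calc ∫ v in r..t, updateInv h v ≤ ∫ _ in r..t, σ :=
        intervalIntegral.integral_mono_on_of_le_Ioo hrt
          (hh.updateInv_intervalIntegrable (hrt.trans ht) ht) (by simp) fun v hv =>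
          hh.updateInv_le_of_le ⟨hr.trans_lt hv.1, hv.2.le.trans ht⟩
            ((hv.2.le.trans htc).trans hσ.le)
    _ = σ * (t - r) := by simp [mul_comm]

end IsUpdate

section stationary

variable {h p s : ℝ → ℝ} (hh : IsUpdate h) (hpm : Monotone p) (hpi : IsInterpolating p)
  (hs : Continuous s) (hsm : Monotone s)
  (hst : ∀ (q : ℝ → ℝ) (N : ℝ), Monotone q → IsInterpolating q → (∀ x, N < |x| → q x = p x) →
    Integrable (fun x => updatePrim h (q x) - updatePrim h (p x) - (q x - p x) * s x) ∧
    0 ≤ ∫ x, (updatePrim h (q x) - updatePrim h (p x) - (q x - p x) * s x))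

include hpi hst in
/-- A stationary profile has no admissible variation along which the potential decreases. -/
theorem not_decreasing_variation {q : ℝ → ℝ} {N η γ x₁ x₂ : ℝ} (hqm : Monotone q)
    (hqI : ∀ x, q x ∈ Icc (0 : ℝ) 1) (hN : ∀ x, N < |x| → q x = p x) (hη : 0 < η) (hγ : 0 < γ)
    (hx : x₁ < x₂) (hE : ∀ x, updatePrim h (q x) - updatePrim h (p x) - (q x - p x) * s x ≤
      -(η * |q x - p x|)) (hgap : ∀ x ∈ Ioo x₁ x₂, γ ≤ |q x - p x|) : False := by
  have hqi : IsInterpolating q := by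
    refine ⟨hqI, hpi.tendsto_atBot.congr' ?_, hpi.tendsto_atTop.congr' ?_⟩
    · filter_upwards [eventually_lt_atBot (-N)] with x hx
      exact (hN x (lt_abs.2 (Or.inr (by linarith)))).symm
    · filter_upwards [eventually_gt_atTop N] with x hx
      exact (hN x (lt_abs.2 (Or.inl hx))).symm
  obtain ⟨hint, h0⟩ := hst q N hqm hqi hN
  have h1 : ∫ x, (updatePrim h (q x) - updatePrim h (p x) - (q x - p x) * s x) ≤
      ∫ x, (Ioo x₁ x₂).indicator (fun _ => -(η * γ)) x := by
    refine integral_mono hint ((integrable_indicator_iff measurableSet_Ioo).2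
      (integrableOn_const (by simp))) fun x => (hE x).trans ?_
    by_cases hx' : x ∈ Ioo x₁ x₂
    · rw [indicator_of_mem hx']
      exact neg_le_neg (mul_le_mul_of_nonneg_left (hgap x hx') hη.le)
    · rw [indicator_of_notMem hx']
      exact neg_nonpos.2 (mul_nonneg hη.le (abs_nonneg _))
  rw [integral_indicator measurableSet_Ioo, setIntegral_const] at h1
  simp only [Real.volume_real_Ioo_of_le hx.le, smul_eq_mul] at h1
  have := mul_pos (sub_pos.2 hx) (mul_pos hη hγ)
  linarith

include hh hpm hpi hs hsm hst

/-- If `p x₀` exceeds `h(s(x₀)+)`, cap `p` at an intermediate level `c` to the left of a point `x₁ >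
x₀`. The primitive drops at rate at least `σ`, while the linear term gives back only `s < τ < σ`. -/
theorem le_rightLim_of_stationary (x₀ : ℝ) :
    p x₀ ≤ Function.rightLim (updateExt h) (s x₀) := by
  by_contra! hlt
  obtain ⟨c, hc1, hc2⟩ := exists_between hlt
  have hc0 : 0 < c := ((hh.updateExt_mem_Icc _).1.trans
    (hh.updateExt_mono.le_rightLim le_rfl)).trans_lt hc1
  obtain ⟨σ, hσ1, hσ2⟩ := (((hh.updateExt_mono.tendsto_rightLim (s x₀)).eventually
    (gt_mem_nhds hc1)).and self_mem_nhdsWithin).exists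
  obtain ⟨τ, hτ1, hτ2⟩ := exists_between (show s x₀ < σ from hσ2)
  obtain ⟨x₁, hx1, hx2⟩ := ((((hs.tendsto x₀).mono_left nhdsWithin_le_nhds).eventually
    (gt_mem_nhds hτ1) : ∀ᶠ y in 𝓝[>] x₀, s y < τ).and self_mem_nhdsWithin).exists
  -- Left of `m` the profile is already below `c`, so the cap changes it only on a bounded set.
  obtain ⟨m, hm⟩ := eventually_atBot.1 (hpi.tendsto_atBot.eventually (gt_mem_nhds hc0))
  have hle : ∀ x, (if x < x₁ then min (p x) c else p x) ≤ p x := by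
    intro x
    split_ifs
    exacts [min_le_left _ _, le_rfl]
  refine not_decreasing_variation hpi hst (q := fun x => if x < x₁ then min (p x) c else p x)
    (N := max |x₁| |m|) (η := σ - τ) (γ := p x₀ - c) ?_ ?_ ?_ (sub_pos.2 hτ2) (sub_pos.2 hc2) hx2
    ?_ ?_
  · intro x y hxy
    have := hpm hxy
    simp only
    split_ifs with h1 h2
    · exact min_le_min this le_rfl
    · exact (min_le_left _ _).trans this
    · exact absurd (hxy.trans_lt ‹_›) h1
    · exact this
  · intro x
    refine ⟨?_, (hle x).trans (hpi.mem_Icc x).2⟩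
    split_ifs
    exacts [le_min (hpi.mem_Icc x).1 hc0.le, (hpi.mem_Icc x).1]
  · intro x hx
    obtain ⟨h1, h2⟩ := max_lt_iff.1 hx
    split_ifs with h3
    · rcases lt_abs.1 h2 with h4 | h4
      · rcases lt_abs.1 h1 with h5 | h5
        · linarith [le_abs_self x₁]
        · linarith [abs_nonneg m, abs_nonneg x₁, le_abs_self m, neg_abs_le x₁]
      · exact min_eq_left (hm x (by linarith [neg_abs_le m])).le
    · rfl
  · intro x
    rw [abs_of_nonpos (sub_nonpos.2 (hle x))]
    split_ifs with h1
    · have hsx : s x < τ := (hsm h1.le).trans_lt hx1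
      rcases le_total (p x) c with h2 | h2
      · rw [min_eq_left h2]
        simp
      · rw [min_eq_right h2]
        have h3 := hh.mul_sub_le_updatePrim_sub hσ1 le_rfl h2 (hpi.mem_Icc x).2
        nlinarith
    · simp
  · intro x hx
    rw [if_pos hx.2, abs_of_nonpos (sub_nonpos.2 (min_le_left _ _))]
    linarith [hpm hx.1.le, min_le_right (p x) c]

/-- Mirror image: raise `p` to a level `c` to the right of a point `x₁ < x₀`. The primitive grows at
rate at most `σ`, while the linear term gains more than `τ > σ`. -/
theorem leftLim_le_of_stationary (x₀ : ℝ) :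
    Function.leftLim (updateExt h) (s x₀) ≤ p x₀ := by
  by_contra! hlt
  obtain ⟨c, hc1, hc2⟩ := exists_between hlt
  have hc0 : c < 1 := hc2.trans_le ((hh.updateExt_mono.leftLim_le le_rfl).trans
    (hh.updateExt_mem_Icc _).2)
  obtain ⟨σ, hσ1, hσ2⟩ := (((hh.updateExt_mono.tendsto_leftLim (s x₀)).eventually
    (lt_mem_nhds hc2)).and self_mem_nhdsWithin).exists
  obtain ⟨τ, hτ1, hτ2⟩ := exists_between (show σ < s x₀ from hσ2)
  obtain ⟨x₁, hx1, hx2⟩ := ((((hs.tendsto x₀).mono_left nhdsWithin_le_nhds).eventually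
    (lt_mem_nhds hτ2) : ∀ᶠ y in 𝓝[<] x₀, τ < s y).and self_mem_nhdsWithin).exists
  -- Needs `c < 1`: beyond `m` the profile already exceeds `c`, which keeps the perturbation
  -- compactly supported.
  obtain ⟨m, hm⟩ := eventually_atTop.1 (hpi.tendsto_atTop.eventually (lt_mem_nhds hc0))
  have hle : ∀ x, p x ≤ (if x₁ < x then max (p x) c else p x) := by
    intro x
    split_ifs
    exacts [le_max_left _ _, le_rfl]
  refine not_decreasing_variation hpi hst (q := fun x => if x₁ < x then max (p x) c else p x)
    (N := max |x₁| |m|) (η := τ - σ) (γ := c - p x₀) ?_ ?_ ?_ (sub_pos.2 hτ1) (sub_pos.2 hc1) hx2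
    ?_ ?_
  · intro x y hxy
    have := hpm hxy
    simp only
    split_ifs with h1 h2
    · exact max_le_max this le_rfl
    · exact absurd (h1.trans_le hxy) h2
    · exact this.trans (le_max_left _ _)
    · exact this
  · intro x
    refine ⟨(hpi.mem_Icc x).1.trans (hle x), ?_⟩
    split_ifs
    exacts [max_le (hpi.mem_Icc x).2 hc0.le, (hpi.mem_Icc x).2]
  · intro x hx
    obtain ⟨h1, h2⟩ := max_lt_iff.1 hx
    split_ifs with h3
    · rcases lt_abs.1 h2 with h4 | h4
      · exact max_eq_left (hm x (by linarith [le_abs_self m])).le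
      · rcases lt_abs.1 h1 with h5 | h5
        · linarith [abs_nonneg m, abs_nonneg x₁]
        · linarith [neg_abs_le x₁]
    · rfl
  · intro x
    rw [abs_of_nonneg (sub_nonneg.2 (hle x))]
    split_ifs with h1
    · have hsx : τ < s x := hx1.trans_le (hsm h1.le)
      rcases le_total c (p x) with h2 | h2
      · rw [max_eq_left h2]
        simp
      · rw [max_eq_right h2]
        have h3 := hh.updatePrim_sub_le_mul_sub hσ1 (hpi.mem_Icc x).1 h2 le_rfl
        nlinarith
    · simp
  · intro x hx
    rw [if_pos hx.1, abs_of_nonneg (sub_nonneg.2 (le_max_left _ _))]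
    linarith [hpm hx.2.le, le_max_right (p x) c]

end stationary

/-! ### Necessity: minimal pairs are consistent -/

theorem IsMinimalPair.isCFP {w hf hg f g : ℝ → ℝ} (hw : IsWindow w)
    (hhf : IsUpdate hf) (hhg : IsUpdate hg) (hphi : phi hf hg 1 1 = 0)
    (hfm : Monotone f) (hgm : Monotone g)
    (hfi : IsInterpolating f) (hgi : IsInterpolating g) (h : IsMinimalPair w hf hg f g) :
    IsCFP w hf hg f g := by
  have hsf := smooth_continuous hw hfm hfi
  have hsg := smooth_continuous hw hgm hgi
  have hmf := smooth_mono hw hfm hfi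
  have hmg := smooth_mono hw hgm hgi
  constructor <;> intro x
  · have hst := fun (q : ℝ → ℝ) (N : ℝ) (hqm : Monotone q) (hqi : IsInterpolating q)
      (hN : ∀ x, N < |x| → q x = f x) =>
      And.intro ((integrable_updatePrim_sub hhf hfm hfi hqm hqi hN).sub
        (integrable_sub_mul_smooth hw hfm hfi hgm hgi hqm hqi hN))
        (h.variation_left hw hhf hhg hphi hfm hgm hfi hgi hqm hqi hN)
    exact ⟨leftLim_le_of_stationary hhf hfm hfi hsg hmg hst x,
      le_rightLim_of_stationary hhf hfm hfi hsg hmg hst x⟩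
  · have hst := fun (q : ℝ → ℝ) (N : ℝ) (hqm : Monotone q) (hqi : IsInterpolating q)
      (hN : ∀ x, N < |x| → q x = g x) =>
      And.intro ((integrable_updatePrim_sub hhg hgm hgi hqm hqi hN).sub
        (integrable_sub_mul_smooth hw hgm hgi hfm hfi hqm hqi hN))
        (h.variation_right hw hhf hhg hphi hfm hgm hfi hgi hqm hqi hN)
    exact ⟨leftLim_le_of_stationary hhg hgm hgi hsf hmf hst x,
      le_rightLim_of_stationary hhg hgm hgi hsf hmf hst x⟩

end SpatialCoupling

end

theorem mainTheorem2 (w hf hg : ℝ → ℝ)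
    (hw : SpatialCoupling.IsWindow w)
    (hhf : SpatialCoupling.IsUpdate hf) (hhg : SpatialCoupling.IsUpdate hg)
    (hphi : SpatialCoupling.phi hf hg 1 1 = 0)
    (f g : ℝ → ℝ) (hfm : Monotone f) (hgm : Monotone g)
    (hfi : SpatialCoupling.IsInterpolating f) (hgi : SpatialCoupling.IsInterpolating g) :
    SpatialCoupling.IsMinimalPair w hf hg f g ↔ SpatialCoupling.IsCFP w hf hg f g :=
  ⟨fun h => h.isCFP hw hhf hhg hphi hfm hgm hfi hgi,
    fun h => h.isMinimalPair hw hhf hhg hfm hgm hfi hgi⟩
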